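/- Let $S$ be a finite non-empty set of points in the Euclidean plane in general position, i.e. no three points of $S$ are collinear. A plane spanning tree on $S$ is a tree with vertex set $S$ whose edges, drawn as straight line segments, pairwise do not cross, i.e. two distinct edges meet at most in a common endpoint. A caterpillar is a tree in which the non-leaf vertices form a (possibly empty or one-vertex) path. Let $\mathcal{C}(S)$ be the set of plane spanning trees on $S$ that are caterpillars. For distinct $T_1=(S,E_1)$, $T_2=(S,E_2)$ in $\mathcal{C}(S)$ with $E_2=(E_1\setminus\{e\})\cup\{f\}$ for some edges $e \in E_1$ and $f \in E_2$, we say that $T_1$ and $T_2$ are connected by a flip; by a compatible flip, if moreover $e$ and $f$ can be chosen so that they do not cross; and by a rotation, if moreover $e$ and $f$ can be chosen so that they share an endpoint. The flip graph, compatible-flip graph and rotation graph of plane spanning caterpillars on $S$ have vertex set $\mathcal{C}(S)$, and two vertices are adjacent when they are connected by a flip, a compatible flip or a rotation, respectively. Then the rotation graph of plane spanning caterpillars on $S$ is connected. Consequently, the flip graph and the compatible-flip graph of plane spanning caterpillars on $S$ are connected as well. -/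

import Mathlib

namespace PlaneCaterpillar

/-- The Euclidean plane. -/
abbrev Plane : Type := EuclideanSpace ℝ (Fin 2)

/-- A finite point set is in general position if no three of its points are collinear. -/
def InGeneralPosition (S : Finset Plane) : Prop :=
  ∀ a ∈ S, ∀ b ∈ S, ∀ c ∈ S, a ≠ b → a ≠ c → b ≠ c → ¬ Collinear ℝ {a, b, c}

/-- The straight-line segment that draws the edge `e` with endpoints in `S`. -/
def edgeSegment {S : Finset Plane} (e : Sym2 S) : Set Plane :=
  convexHull ℝ {p | ∃ v ∈ e, (v : Plane) = p}

theorem edgeSegment_mk {S : Finset Plane} (a b : S) :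
    edgeSegment s(a, b) = segment ℝ (a : Plane) b := by
  rw [edgeSegment, ← convexHull_pair]
  congr 1
  ext p
  simp [eq_comm]

/-- Two (distinct) edges do not cross if their segments meet at most in a common endpoint. -/
def NonCrossing {S : Finset Plane} (e f : Sym2 S) : Prop :=
  edgeSegment e ∩ edgeSegment f ⊆ {p | ∃ v, v ∈ e ∧ v ∈ f ∧ (v : Plane) = p}

/-- A geometric graph on `S` is plane if no two distinct edges of it cross. -/
def IsPlane {S : Finset Plane} (T : SimpleGraph S) : Prop :=
  ∀ e ∈ T.edgeSet, ∀ f ∈ T.edgeSet, e ≠ f → NonCrossing e f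

/-- A leaf is a vertex with exactly one neighbour. -/
def IsLeaf {V : Type*} (T : SimpleGraph V) (v : V) : Prop :=
  ∃! w, T.Adj v w

/-- A caterpillar is a tree whose non-leaf vertices form a (possibly empty) path, its spine;
here the spine is given as the list of its vertices in order. -/
def IsCaterpillar {V : Type*} (T : SimpleGraph V) : Prop :=
  T.IsTree ∧ ∃ spine : List V,
    spine.Nodup ∧ spine.IsChain T.Adj ∧ ∀ v, v ∈ spine ↔ ¬ IsLeaf T v

/-- The set of plane spanning caterpillars on `S`. -/
abbrev Caterpillar (S : Finset Plane) : Type :=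
  {T : SimpleGraph S // IsPlane T ∧ IsCaterpillar T}

/-- `T₂` arises from `T₁` by exchanging the edge `e` for the edge `f`. -/
def Exchange {S : Finset Plane} (T₁ T₂ : SimpleGraph S) (e f : Sym2 S) : Prop :=
  e ∈ T₁.edgeSet ∧ f ∈ T₂.edgeSet ∧ T₂.edgeSet = (T₁.edgeSet \ {e}) ∪ {f}

def IsFlip {S : Finset Plane} (T₁ T₂ : SimpleGraph S) : Prop :=
  ∃ e f, Exchange T₁ T₂ e f

/-- A compatible flip is a flip whose exchanged edges do not cross. -/
def IsCompatibleFlip {S : Finset Plane} (T₁ T₂ : SimpleGraph S) : Prop :=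
  ∃ e f, Exchange T₁ T₂ e f ∧ NonCrossing e f

/-- A rotation is a flip whose exchanged edges share an endpoint. -/
def IsRotation {S : Finset Plane} (T₁ T₂ : SimpleGraph S) : Prop :=
  ∃ e f, Exchange T₁ T₂ e f ∧ ∃ v, v ∈ e ∧ v ∈ f

/-- The flip graph of plane spanning caterpillars: two distinct caterpillars are adjacent if one
arises from the other by a flip. -/
def flipGraph (S : Finset Plane) : SimpleGraph (Caterpillar S) :=
  SimpleGraph.fromRel fun C₁ C₂ => IsFlip C₁.1 C₂.1

/-- The compatible-flip graph of plane spanning caterpillars. -/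
def compatibleFlipGraph (S : Finset Plane) : SimpleGraph (Caterpillar S) :=
  SimpleGraph.fromRel fun C₁ C₂ => IsCompatibleFlip C₁.1 C₂.1

/-- The rotation graph of plane spanning caterpillars. -/
def rotationGraph (S : Finset Plane) : SimpleGraph (Caterpillar S) :=
  SimpleGraph.fromRel fun C₁ C₂ => IsRotation C₁.1 C₂.1

end PlaneCaterpillar

/-! A caterpillar is a path `P` with every other vertex attached to some path vertex by a map `f`.
This description (`pathAttach`, `IsSkeleton`) is deliberately not unique: an end of `P` carrying no
attached vertex may be dropped from `P` and regarded as attached to its successor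
(`pathAttach_cons_cons`). Hence, if the first path vertex `p` can be freed of its attached vertices
by rotations, `P` gets shorter, and induction ends at the star centred at the last vertex of `P`
(`joined_star`). A star at `r` is also described by the path `[r, q]` with everything else attached
to `r`, so the same result turns it into the star at `q`; all caterpillars are therefore connected.

The geometric core is `exists_joined_fewer`, which moves one vertex `l` away from `p`. Let `s` be
the successor of `p`. On one side of the line `ps`, take `l` to be the vertex attached to `p` that
is angularly closest to the ray `ps`, and let `u` be the first path vertex met when the ray from `l`
through `p` turns towards `s`. The triangle bounded by `pl`, `ps` and the line `lu` then has no path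
vertex in its interior, and no edge can leave it through the tree edges `pl` and `ps`. Its interior
vertices are reattached to `p`, then to `u`; after that `lu` is crossed by nothing and `l` can
rotate to `u`. Every move keeps the path and changes one attachment, so it is a rotation and the
result is again a caterpillar; only planarity needs an argument. -/

namespace PlaneCaterpillar

/-! ### Caterpillars as a path with attached vertices. -/

section Combinatorics

variable {V : Type*}

/-- The graph consisting of the path through the vertices of the list `P`, together with the edges
that attach every vertex `v` outside of `P` to the vertex `f v`. -/
def pathAttach (P : List V) (f : V → V) : SimpleGraph V :=
  SimpleGraph.fromRel fun a b => [a, b] <:+: P ∨ (a ∉ P ∧ f a = b)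

/-- The list `P` and the map `f` describe a caterpillar: `P` is a non-empty list without repetitions
and `f` attaches every other vertex to a vertex of `P`. -/
structure IsSkeleton (P : List V) (f : V → V) : Prop where
  nodup : P.Nodup
  ne_nil : P ≠ []
  mem : ∀ v, v ∉ P → f v ∈ P

theorem pair_infix_cons_cons {a b p s : V} {Q : List V} :
    [a, b] <:+: p :: s :: Q ↔ (a = p ∧ b = s) ∨ [a, b] <:+: s :: Q := by
  rw [List.infix_cons_iff, List.cons_prefix_cons, List.cons_prefix_cons]
  simp

theorem not_pair_infix_singleton {a b r : V} : ¬ [a, b] <:+: [r] := by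
  intro h
  simpa using h.length_le

theorem ne_of_pair_infix {a b : V} {P : List V} (hP : P.Nodup) (h : [a, b] <:+: P) : a ≠ b := by
  simpa using hP.sublist h.sublist

theorem left_mem_of_pair_infix {a b : V} {P : List V} (h : [a, b] <:+: P) : a ∈ P :=
  h.subset (by simp)

theorem right_mem_of_pair_infix {a b : V} {P : List V} (h : [a, b] <:+: P) : b ∈ P :=
  h.subset (by simp)

theorem pair_infix_reverse {a b : V} {P : List V} : [a, b] <:+: P.reverse ↔ [b, a] <:+: P := by
  rw [← List.reverse_infix (l₁ := [b, a])]
  simp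

theorem isChain_iff_pair_infix {R : V → V → Prop} {P : List V} :
    P.IsChain R ↔ ∀ a b, [a, b] <:+: P → R a b := by
  rw [List.isChain_iff_forall_rel_of_append_cons_cons]
  constructor
  · rintro h a b ⟨A, B, hAB⟩
    exact h (l₁ := A) (l₂ := B) (by simp [← hAB])
  · intro h a b A B hAB
    exact h a b ⟨A, B, by simp [hAB]⟩

theorem pathAttach_adj {P : List V} {f : V → V} {a b : V} :
    (pathAttach P f).Adj a b ↔ a ≠ b ∧
      (([a, b] <:+: P ∨ (a ∉ P ∧ f a = b)) ∨ ([b, a] <:+: P ∨ (b ∉ P ∧ f b = a))) :=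
  SimpleGraph.fromRel_adj _ _ _

theorem pathAttach_adj_attach {P : List V} {f : V → V} (h : IsSkeleton P f) {v : V} (hv : v ∉ P) :
    (pathAttach P f).Adj v (f v) :=
  pathAttach_adj.2 ⟨fun e => hv (e ▸ h.mem v hv), .inl (.inr ⟨hv, rfl⟩)⟩

theorem pathAttach_adj_of_pair_infix {P : List V} {f : V → V} (h : P.Nodup) {a b : V}
    (hab : [a, b] <:+: P) : (pathAttach P f).Adj a b :=
  pathAttach_adj.2 ⟨ne_of_pair_infix h hab, .inl (.inl hab)⟩

theorem pathAttach_adj_of_notMem {P : List V} {f : V → V} (h : IsSkeleton P f) {v w : V}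
    (hv : v ∉ P) (hvw : (pathAttach P f).Adj v w) : w = f v := by
  rw [pathAttach_adj] at hvw
  rcases hvw with ⟨-, (h1 | h1) | (h1 | h1)⟩
  · exact absurd (left_mem_of_pair_infix h1) hv
  · exact h1.2.symm
  · exact absurd (right_mem_of_pair_infix h1) hv
  · exact absurd (h1.2 ▸ h.mem w h1.1) hv

theorem pathAttach_congr {P : List V} {f g : V → V} (h : ∀ v, v ∉ P → f v = g v) :
    pathAttach P f = pathAttach P g := by
  ext a b
  simp only [pathAttach_adj]
  have := h a
  have := h b
  grind

theorem pathAttach_reverse (P : List V) (f : V → V) :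
    pathAttach P.reverse f = pathAttach P f := by
  ext a b
  simp only [pathAttach_adj, pair_infix_reverse, List.mem_reverse]
  tauto

theorem IsSkeleton.reverse {P : List V} {f : V → V} (h : IsSkeleton P f) :
    IsSkeleton P.reverse f :=
  ⟨List.nodup_reverse.2 h.nodup, by simpa using h.ne_nil, by simpa using h.mem⟩

/-- A first path vertex without attached vertices can itself be viewed as an attached vertex. -/
theorem pathAttach_cons_cons [DecidableEq V] {p s : V} {Q : List V} {f : V → V}
    (h : IsSkeleton (p :: s :: Q) f) (hf : ∀ v, v ∉ p :: s :: Q → f v ≠ p) :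
    IsSkeleton (s :: Q) (Function.update f p s) ∧
      pathAttach (s :: Q) (Function.update f p s) = pathAttach (p :: s :: Q) f := by
  have hp : p ∉ s :: Q := (List.nodup_cons.1 h.nodup).1
  constructor
  · refine ⟨(List.nodup_cons.1 h.nodup).2, by simp, fun v hv => ?_⟩
    by_cases hvp : v = p
    · simp [hvp]
    · rw [Function.update_of_ne hvp]
      have h1 : v ∉ p :: s :: Q := by
        rw [List.mem_cons]; tauto
      exact (List.mem_cons.1 (h.mem v h1)).resolve_left (hf v h1)
  · ext a b
    simp only [pathAttach_adj, pair_infix_cons_cons]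
    have ha := hf a
    have hb := hf b
    simp only [List.mem_cons, Function.update_apply] at *
    grind

theorem pathAttach_connected {P : List V} {f : V → V} (h : IsSkeleton P f) :
    (pathAttach P f).Connected := by
  obtain ⟨p, Q, rfl⟩ := List.exists_cons_of_ne_nil h.ne_nil
  have hpath : ∀ (R : List V) (q : V),
      (∀ a b, [a, b] <:+: q :: R → (pathAttach (p :: Q) f).Adj a b) →
      ∀ v ∈ q :: R, (pathAttach (p :: Q) f).Reachable q v := by
    intro R
    induction R with
    | nil => intro q _ v hv; simp at hv; subst hv; rfl
    | cons s R ih =>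
      intro q hq v hv
      rcases List.mem_cons.1 hv with rfl | hv
      · rfl
      · exact (hq q s (pair_infix_cons_cons.2 (.inl ⟨rfl, rfl⟩))).reachable.trans
          (ih s (fun a b hab => hq a b (pair_infix_cons_cons.2 (.inr hab))) v hv)
  have hp := hpath Q p fun a b hab => pathAttach_adj_of_pair_infix h.nodup hab
  refine (SimpleGraph.connected_iff_exists_forall_reachable _).2 ⟨p, fun v => ?_⟩
  by_cases hv : v ∈ p :: Q
  · exact hp v hv
  · exact (hp _ (h.mem v hv)).trans (pathAttach_adj_attach h hv).symm.reachable

theorem exists_finset_pair_infix [DecidableEq V] (Q : List V) (p : V) :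
    ∃ E : Finset (Sym2 V), E.card ≤ Q.length ∧ ∀ a b, [a, b] <:+: p :: Q → s(a, b) ∈ E := by
  induction Q generalizing p with
  | nil => exact ⟨∅, by simp, fun a b h => absurd h not_pair_infix_singleton⟩
  | cons s Q ih =>
    obtain ⟨E, hE, hE'⟩ := ih s
    refine ⟨insert s(p, s) E, (Finset.card_insert_le _ _).trans (by simpa using hE), ?_⟩
    intro a b hab
    rcases pair_infix_cons_cons.1 hab with ⟨rfl, rfl⟩ | hab
    · simp
    · exact Finset.mem_insert_of_mem (hE' a b hab)

/-- The graph is connected, and counting one edge per consecutive pair of `P` and one per vertex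
outside `P` bounds its edges by the number of vertices minus one. -/
theorem pathAttach_isTree [Finite V] {P : List V} {f : V → V} (h : IsSkeleton P f) :
    (pathAttach P f).IsTree := by
  classical
  have := Fintype.ofFinite V
  have hc := pathAttach_connected h
  rw [SimpleGraph.isTree_iff_connected_and_card]
  refine ⟨hc, le_antisymm ?_ hc.card_vert_le_card_edgeSet_add_one⟩
  obtain ⟨p, Q, rfl⟩ := List.exists_cons_of_ne_nil h.ne_nil
  obtain ⟨E, hE, hE'⟩ := exists_finset_pair_infix Q p
  set A : Finset V := Finset.univ \ (p :: Q).toFinset with hA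
  have hsub : (pathAttach (p :: Q) f).edgeSet ⊆ ↑(E ∪ A.image fun v => s(v, f v)) := by
    intro e
    induction e using Sym2.ind with
    | _ a b =>
      intro hab
      rw [SimpleGraph.mem_edgeSet, pathAttach_adj] at hab
      simp only [Finset.coe_union, Set.mem_union, Finset.mem_coe, Finset.mem_image]
      rcases hab with ⟨-, (h1 | h1) | (h1 | h1)⟩
      · exact .inl (hE' _ _ h1)
      · exact .inr ⟨a, by simpa [hA] using h1.1, by rw [h1.2]⟩
      · exact .inl (Sym2.eq_swap ▸ hE' _ _ h1)
      · exact .inr ⟨b, by simpa [hA] using h1.1, by rw [h1.2, Sym2.eq_swap]⟩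
  have h1 : Nat.card (pathAttach (p :: Q) f).edgeSet ≤ E.card + A.card := by
    rw [Nat.card_coe_set_eq]
    refine (Set.ncard_le_ncard hsub (Finset.finite_toSet _)).trans ?_
    rw [Set.ncard_coe_finset]
    exact (Finset.card_union_le _ _).trans (Nat.add_le_add_left Finset.card_image_le _)
  have h2 : A.card + (Q.length + 1) = Nat.card V := by
    rw [Nat.card_eq_fintype_card, ← Finset.card_univ,
      ← Finset.card_sdiff_add_card_eq_card (Finset.subset_univ (p :: Q).toFinset),
      List.toFinset_card_of_nodup h.nodup, List.length_cons]
  omega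

theorem isLeaf_of_notMem {P : List V} {f : V → V} (h : IsSkeleton P f) {v : V} (hv : v ∉ P) :
    IsLeaf (pathAttach P f) v :=
  ⟨f v, pathAttach_adj_attach h hv, fun _ hw => pathAttach_adj_of_notMem h hv hw⟩

/-- Vertices outside `P` are leaves, and an interior vertex of `P` has two neighbours, so only the
ends of `P` can be superfluous. An end that is a leaf carries no attached vertex and can be peeled
off; induct on the length. -/
theorem exists_spine {P : List V} {f : V → V} (h : IsSkeleton P f) :
    ∃ spine : List V, spine.Nodup ∧ spine.IsChain (pathAttach P f).Adj ∧
      ∀ v, v ∈ spine ↔ ¬ IsLeaf (pathAttach P f) v := by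
  classical
  induction hn : P.length using Nat.strong_induction_on generalizing P f with
  | _ n ih =>
  subst hn
  have hdrop : ∀ (P' : List V), P'.length = P.length → IsSkeleton P' f →
      pathAttach P' f = pathAttach P f → ∀ p s Q, P' = p :: s :: Q →
      IsLeaf (pathAttach P f) p → ∃ spine : List V, spine.Nodup ∧
        spine.IsChain (pathAttach P f).Adj ∧ ∀ v, v ∈ spine ↔ ¬ IsLeaf (pathAttach P f) v := by
    rintro P' hlen h' hG p s Q rfl ⟨w, -, hw⟩
    obtain ⟨h1, h2⟩ := pathAttach_cons_cons h' (fun v hv hfv => by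
      have e1 := hw v (hG ▸ hfv ▸ (pathAttach_adj_attach h' hv).symm)
      have e2 := hw s (hG ▸ pathAttach_adj_of_pair_infix h'.nodup
        (pair_infix_cons_cons.2 (.inl ⟨rfl, rfl⟩)))
      subst e1
      subst e2
      simp at hv)
    have := ih (s :: Q).length (by rw [← hlen]; simp) h1 rfl
    rwa [h2, hG] at this
  by_cases hall : ∀ v ∈ P, ¬ IsLeaf (pathAttach P f) v
  · exact ⟨P, h.nodup, isChain_iff_pair_infix.2 fun a b => pathAttach_adj_of_pair_infix h.nodup,
      fun v => ⟨hall v, fun hv => by_contra fun hv' => hv (isLeaf_of_notMem h hv')⟩⟩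
  push Not at hall
  obtain ⟨v, hv, hleaf⟩ := hall
  obtain ⟨A, B, hAB⟩ := List.append_of_mem hv
  rcases A.eq_nil_or_concat with rfl | ⟨A', a, rfl⟩
  -- If `P` is a single vertex that is a leaf, every vertex is a leaf and the spine is empty.
  · cases B with
    | nil =>
      refine ⟨[], by simp, by simp, fun w => ?_⟩
      simp only [List.not_mem_nil, false_iff, not_not]
      by_cases hw : w = v
      · exact hw ▸ hleaf
      · exact isLeaf_of_notMem h (by simp [hAB, hw])
    | cons s Q => exact hdrop P rfl h rfl v s Q (by simpa using hAB) hleaf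
  · cases B with
    | nil =>
      exact hdrop P.reverse (by simp) h.reverse (pathAttach_reverse P f) v a A'.reverse
        (by simp [hAB]) hleaf
    | cons b B' =>
      obtain ⟨w, -, hw⟩ := hleaf
      have ha : [a, v] <:+: P := ⟨A', b :: B', by simp [hAB]⟩
      have hb : [v, b] <:+: P := ⟨A' ++ [a], B', by simp [hAB]⟩
      have e1 := hw a (pathAttach_adj_of_pair_infix h.nodup ha).symm
      have e2 := hw b (pathAttach_adj_of_pair_infix h.nodup hb)
      have hnd := h.nodup
      rw [hAB, e1, e2] at hnd
      simp [List.nodup_append] at hnd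

theorem pathAttach_isCaterpillar [Finite V] {P : List V} {f : V → V} (h : IsSkeleton P f) :
    IsCaterpillar (pathAttach P f) :=
  ⟨pathAttach_isTree h, exists_spine h⟩

/-- A tree is minimal among connected graphs, so a skeleton whose graph lies inside `T` already
gives all of `T`. The spine serves as `P`, since two adjacent leaves would make up the whole tree.
-/
theorem IsCaterpillar.exists_eq_pathAttach {T : SimpleGraph V} (hT : IsCaterpillar T) :
    ∃ P f, IsSkeleton P f ∧ T = pathAttach P f := by
  classical
  obtain ⟨htree, spine, hnd, hchain, hspine⟩ := hT
  suffices h : ∃ P f, IsSkeleton P f ∧ pathAttach P f ≤ T by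
    obtain ⟨P, f, h, hle⟩ := h
    exact ⟨P, f, h, le_antisymm ((SimpleGraph.isTree_iff_minimal_connected.1 htree).2
      (pathAttach_connected h) hle) hle⟩
  have hleaf : ∀ v, v ∉ spine → IsLeaf T v := fun v hv => by
    by_contra h; exact hv ((hspine v).2 h)
  have hmk : ∀ P : List V, P.Nodup → P ≠ [] → P.IsChain T.Adj →
      (∀ v, v ∉ P → ∃ w ∈ P, T.Adj v w) → ∃ P f, IsSkeleton P f ∧ pathAttach P f ≤ T := by
    intro P h1 h2 h3 h4
    choose! f hf hf' using h4
    refine ⟨P, f, ⟨h1, h2, hf⟩, fun a b hab => ?_⟩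
    rw [isChain_iff_pair_infix] at h3
    rcases (pathAttach_adj.1 hab).2 with (h | h) | (h | h)
    · exact h3 _ _ h
    · exact h.2 ▸ hf' a h.1
    · exact (h3 _ _ h).symm
    · exact h.2 ▸ (hf' b h.1).symm
  have hclosed : ∀ v w, v ∉ spine → w ∉ spine → T.Adj v w → ∀ x, x = v ∨ x = w := by
    intro v w hv hw hvw x
    have hall : ∀ {y z} (W : T.Walk y z), (y = v ∨ y = w) → z = v ∨ z = w := by
      intro y z W
      induction W with
      | nil => exact id
      | cons hadj _ ih =>
        intro hy
        apply ih
        rcases hy with rfl | rfl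
        · exact .inr ((hleaf _ hv).unique hadj hvw)
        · exact .inl ((hleaf _ hw).unique hadj hvw.symm)
    exact hall (htree.connected.preconnected v x).some (.inl rfl)
  -- An empty spine means that `T` is a single edge; either endpoint is a valid one-vertex path.
  by_cases hs : spine = []
  · subst hs
    obtain ⟨v⟩ := htree.connected.nonempty
    obtain ⟨w, hvw, -⟩ := hleaf v (by simp)
    refine hmk [w] (by simp) (by simp) (by simp) fun x hx => ⟨w, by simp, ?_⟩
    rcases hclosed v w (by simp) (by simp) hvw x with rfl | rfl
    · exact hvw
    · simp at hx
  · refine hmk spine hnd hs hchain fun v hv => ?_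
    obtain ⟨w, hvw, -⟩ := hleaf v hv
    refine ⟨w, by_contra fun hw => ?_, hvw⟩
    obtain ⟨x, hx⟩ := List.exists_mem_of_ne_nil _ hs
    rcases hclosed v w hv hw hvw x with rfl | rfl
    · exact hv hx
    · exact hw hx

/-- Reattaching a vertex exchanges its edge. -/
theorem edgeSet_pathAttach_update [DecidableEq V] {P : List V} {f : V → V} (h : IsSkeleton P f)
    {x u : V} (hx : x ∉ P) (hu : u ∈ P) :
    (pathAttach P (Function.update f x u)).edgeSet =
      ((pathAttach P f).edgeSet \ {s(x, f x)}) ∪ {s(x, u)} := by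
  have hxu : x ≠ u := fun e => hx (e ▸ hu)
  have hfx := h.mem x hx
  ext e
  induction e using Sym2.ind with
  | _ a b =>
    simp only [SimpleGraph.mem_edgeSet, Set.mem_union, Set.mem_sdiff, Set.mem_singleton_iff,
      pathAttach_adj, Sym2.eq_iff, Function.update_apply]
    have h1 := @left_mem_of_pair_infix _ a b P
    have h2 := @right_mem_of_pair_infix _ a b P
    have h3 := @left_mem_of_pair_infix _ b a P
    have h4 := @right_mem_of_pair_infix _ b a P
    have h5 := h.mem a
    have h6 := h.mem b
    grind

theorem IsSkeleton.update [DecidableEq V] {P : List V} {f : V → V} (h : IsSkeleton P f) (x : V)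
    {u : V} (hu : u ∈ P) : IsSkeleton P (Function.update f x u) := by
  refine ⟨h.nodup, h.ne_nil, fun v hv => ?_⟩
  rw [Function.update_apply]
  split_ifs
  · exact hu
  · exact h.mem v hv

end Combinatorics

/-! ### Affine coordinates and crossings in general position. -/

section Geometry

/-- Affine coordinates with respect to three non-collinear points. -/
theorem exists_affine_coordinates {p l s : Plane} (h : ¬ Collinear ℝ {p, l, s}) :
    ∃ α β : Plane →ᵃ[ℝ] ℝ, α p = 0 ∧ β p = 0 ∧ α l = 1 ∧ β l = 0 ∧ α s = 0 ∧ β s = 1 ∧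
      ∀ x y, α x = α y → β x = β y → x = y := by
  have hind : AffineIndependent ℝ ![p, l, s] := affineIndependent_iff_not_collinear_set.2 h
  have htop : affineSpan ℝ (Set.range ![p, l, s]) = ⊤ :=
    hind.affineSpan_eq_top_iff_card_eq_finrank_add_one.2 (by simp)
  let B : AffineBasis (Fin 3) ℝ Plane := ⟨![p, l, s], hind, htop⟩
  have e0 : B 0 = p := rfl
  have e1 : B 1 = l := rfl
  have e2 : B 2 = s := rfl
  refine ⟨B.coord 1, B.coord 2, ?_, ?_, ?_, ?_, ?_, ?_, fun x y h1 h2 => ?_⟩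
  · rw [← e0, B.coord_apply]; simp
  · rw [← e0, B.coord_apply]; simp
  · rw [← e1, B.coord_apply]; simp
  · rw [← e1, B.coord_apply]; simp
  · rw [← e2, B.coord_apply]; simp
  · rw [← e2, B.coord_apply]; simp
  · have hx := B.sum_coord_apply_eq_one x
    have hy := B.sum_coord_apply_eq_one y
    rw [Fin.sum_univ_three] at hx hy
    apply B.ext_elem
    intro i
    fin_cases i
    · show B.coord 0 x = B.coord 0 y
      linarith
    · exact h1
    · exact h2

theorem collinear_lineMap (a b : Plane) (t : ℝ) :
    Collinear ℝ {a, b, AffineMap.lineMap a b t} := by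
  have : Collinear ℝ {AffineMap.lineMap a b t, a, b} :=
    collinear_insert_of_mem_affineSpan_pair (AffineMap.lineMap_mem_affineSpan_pair t a b)
  convert this using 1
  ext x
  simp only [Set.mem_insert_iff, Set.mem_singleton_iff]
  tauto

variable {S : Finset Plane}

theorem InGeneralPosition.not_collinear (hS : InGeneralPosition S) {a b c : S} (hab : a ≠ b)
    (hac : a ≠ c) (hbc : b ≠ c) : ¬ Collinear ℝ {(a : Plane), (b : Plane), (c : Plane)} :=
  hS a a.2 b b.2 c c.2 (Subtype.coe_injective.ne hab) (Subtype.coe_injective.ne hac)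
    (Subtype.coe_injective.ne hbc)

theorem InGeneralPosition.notMem_segment (hS : InGeneralPosition S) {a b c : S} (hab : a ≠ b)
    (hac : a ≠ c) (hbc : b ≠ c) : (c : Plane) ∉ segment ℝ (a : Plane) b := by
  rw [segment_eq_image_lineMap]
  rintro ⟨t, -, ht⟩
  have := collinear_lineMap (a : Plane) b t
  rw [ht] at this
  exact hS.not_collinear hab hac hbc this

theorem NonCrossing.symm {e f : Sym2 S} (h : NonCrossing e f) : NonCrossing f e := by
  rintro p ⟨h1, h2⟩
  obtain ⟨v, hv, hv', hp⟩ := h ⟨h2, h1⟩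
  exact ⟨v, hv', hv, hp⟩

theorem InGeneralPosition.nonCrossing_of_common (hS : InGeneralPosition S) {a b c : S}
    (hab : a ≠ b) (hac : a ≠ c) (hbc : b ≠ c) : NonCrossing s(a, b) s(a, c) := by
  rintro z ⟨h1, h2⟩
  rw [edgeSegment_mk, segment_eq_image_lineMap] at h1 h2
  obtain ⟨r, -, rfl⟩ := h1
  obtain ⟨t, -, ht⟩ := h2
  refine ⟨a, by simp, by simp, ?_⟩
  by_cases hr : r = 0
  · simp [hr]
  exfalso
  apply hS.not_collinear hac hab hbc.symm
  have hb : (b : Plane) = AffineMap.lineMap (a : Plane) (c : Plane) (t / r) := by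
    rw [AffineMap.lineMap_apply_module'] at ht ⊢
    rw [AffineMap.lineMap_apply_module'] at ht
    have h3 : t • ((c : Plane) - a) = r • ((b : Plane) - a) := add_right_cancel ht
    rw [div_eq_inv_mul, mul_smul, h3, smul_smul, inv_mul_cancel₀ hr, one_smul, sub_add_cancel]
  rw [hb]
  exact collinear_lineMap _ _ _

theorem InGeneralPosition.nonCrossing_of_mem (hS : InGeneralPosition S) {e f : Sym2 S} {v : S}
    (he : ¬ e.IsDiag) (hf : ¬ f.IsDiag) (hef : e ≠ f) (hve : v ∈ e) (hvf : v ∈ f) :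
    NonCrossing e f := by
  obtain ⟨b, rfl⟩ := hve
  obtain ⟨c, rfl⟩ := hvf
  exact hS.nonCrossing_of_common (by simpa using he) (by simpa using hf) fun h => hef (by rw [h])

/-- General position settles edges with a common endpoint and keeps the endpoints of one edge off
any disjoint edge, so only interior points remain to be checked. -/
theorem InGeneralPosition.nonCrossing_of_forall_openSegment (hS : InGeneralPosition S)
    {x u a b : S} (hxu : x ≠ u) (hab : a ≠ b) (hne : s(x, u) ≠ s(a, b))
    (h : a ≠ x → a ≠ u → b ≠ x → b ≠ u →
      ∀ z ∈ openSegment ℝ (x : Plane) u, z ∉ segment ℝ (a : Plane) b) :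
    NonCrossing s(x, u) s(a, b) := by
  by_cases hc : ∃ v, v ∈ s(x, u) ∧ v ∈ s(a, b)
  · obtain ⟨v, h1, h2⟩ := hc
    exact hS.nonCrossing_of_mem (by simpa) (by simpa) hne h1 h2
  have hax : a ≠ x := fun e => hc ⟨a, by simp [e], by simp⟩
  have hau : a ≠ u := fun e => hc ⟨a, by simp [e], by simp⟩
  have hbx : b ≠ x := fun e => hc ⟨b, by simp [e], by simp⟩
  have hbu : b ≠ u := fun e => hc ⟨b, by simp [e], by simp⟩
  rintro z ⟨h1, h2⟩
  rw [edgeSegment_mk] at h1 h2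
  exfalso
  rw [← insert_endpoints_openSegment] at h1
  rcases h1 with rfl | rfl | h1
  · exact hS.notMem_segment hab hax hbx h2
  · exact hS.notMem_segment hab hau hbu h2
  · exact h hax hau hbx hbu z h1 h2

end Geometry

/-! ### Single rotations and greedy sequences of them. -/

section Moves

variable {S : Finset Plane}

/-- Two graphs are plane spanning caterpillars joined by a sequence of rotations. -/
def Joined (T T' : SimpleGraph S) : Prop :=
  ∃ (h : IsPlane T ∧ IsCaterpillar T) (h' : IsPlane T' ∧ IsCaterpillar T'),
    (rotationGraph S).Reachable ⟨T, h⟩ ⟨T', h'⟩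

theorem Joined.refl {T : SimpleGraph S} (h : IsPlane T ∧ IsCaterpillar T) : Joined T T :=
  ⟨h, h, .refl _⟩

theorem Joined.trans {T T' T'' : SimpleGraph S} (h : Joined T T') (h' : Joined T' T'') :
    Joined T T'' := by
  obtain ⟨h1, h2, h3⟩ := h
  obtain ⟨_, h5, h6⟩ := h'
  exact ⟨h1, h5, h3.trans h6⟩

theorem Joined.isPlane {T T' : SimpleGraph S} (h : Joined T T') : IsPlane T' := h.2.1.1

/-- No edge of `T` without an endpoint in `{x, u}` meets the open segment from `x` to `u`. -/
def IsFree (T : SimpleGraph S) (x u : S) : Prop :=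
  ∀ a b, T.Adj a b → a ≠ x → a ≠ u → b ≠ x → b ≠ u →
    ∀ z ∈ openSegment ℝ (x : Plane) u, z ∉ segment ℝ (a : Plane) b

open Classical in
theorem joined_update (hS : InGeneralPosition S) {P : List S} {f : S → S} (h : IsSkeleton P f)
    (hpl : IsPlane (pathAttach P f)) {x u : S} (hx : x ∉ P) (hu : u ∈ P)
    (hfree : IsFree (pathAttach P f) x u) :
    Joined (pathAttach P f) (pathAttach P (Function.update f x u)) := by
  have hxu : x ≠ u := fun e => hx (e ▸ hu)
  have hes := edgeSet_pathAttach_update h hx hu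
  have hnc : ∀ e ∈ (pathAttach P f).edgeSet, e ≠ s(x, u) → NonCrossing s(x, u) e := by
    intro e
    induction e using Sym2.ind with
    | _ a b =>
      intro he hne
      rw [SimpleGraph.mem_edgeSet] at he
      exact hS.nonCrossing_of_forall_openSegment hxu he.ne hne.symm (hfree a b he)
  have hpl' : IsPlane (pathAttach P (Function.update f x u)) := by
    intro e he e' he' hne
    rw [hes] at he he'
    rcases he with he | rfl
    · rcases he' with he' | rfl
      · exact hpl e he.1 e' he'.1 hne
      · exact (hnc e he.1 hne).symm
    · rcases he' with he' | rfl
      · exact hnc e' he'.1 hne.symm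
      · exact absurd rfl hne
  have hc := pathAttach_isCaterpillar h
  have hc' := pathAttach_isCaterpillar (h.update x hu)
  refine ⟨⟨hpl, hc⟩, ⟨hpl', hc'⟩, ?_⟩
  by_cases heq : pathAttach P f = pathAttach P (Function.update f x u)
  · simp only [← heq]; rfl
  refine SimpleGraph.Adj.reachable ?_
  refine (SimpleGraph.fromRel_adj _ _ _).2 ⟨fun e => heq (congrArg Subtype.val e), .inl ?_⟩
  exact ⟨s(x, f x), s(x, u), ⟨pathAttach_adj_attach h hx, by simp [hes], hes⟩, x, by simp, by simp⟩

open Classical in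
/-- The vertices of `A` can be reattached to `t` one after the other, if this is possible for a
vertex with the smallest key among those that are still to be reattached. -/
theorem joined_reattach (hS : InGeneralPosition S) {P : List S} {f : S → S} (h : IsSkeleton P f)
    (hpl : IsPlane (pathAttach P f)) (A : Finset S) (hA : ∀ x ∈ A, x ∉ P) {t : S} (ht : t ∈ P)
    (key : S → ℝ)
    (hfree : ∀ g, IsSkeleton P g → IsPlane (pathAttach P g) → (∀ x ∉ A, g x = f x) →
      (∀ x ∈ A, g x = f x ∨ g x = t) → ∀ w ∈ A, g w ≠ t →
      (∀ x ∈ A, g x ≠ t → key w ≤ key x) → IsFree (pathAttach P g) w t) :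
    IsSkeleton P (fun x => if x ∈ A then t else f x) ∧
    Joined (pathAttach P f) (pathAttach P fun x => if x ∈ A then t else f x) := by
  -- Induct on the number of vertices of `A` not yet attached to `t`, over all intermediate
  -- attachments `g`.
  refine ⟨⟨h.nodup, h.ne_nil, fun v hv => by split_ifs; exacts [ht, h.mem v hv]⟩, ?_⟩
  have main : ∀ (n : ℕ) (g : S → S), (A.filter fun x => g x ≠ t).card = n → IsSkeleton P g →
      IsPlane (pathAttach P g) → (∀ x ∉ A, g x = f x) → (∀ x ∈ A, g x = f x ∨ g x = t) →
      Joined (pathAttach P g) (pathAttach P fun x => if x ∈ A then t else f x) := by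
    intro n
    induction n with
    | zero =>
      intro g hn hg hgp h1 h2
      have : (fun x => if x ∈ A then t else f x) = g := by
        funext x
        split_ifs with hx
        · by_contra hne
          have := Finset.card_eq_zero.1 hn
          exact (Finset.notMem_empty x) (this ▸ Finset.mem_filter.2 ⟨hx, Ne.symm hne⟩)
        · exact (h1 x hx).symm
      rw [this]
      exact .refl ⟨hgp, pathAttach_isCaterpillar hg⟩
    | succ n ih =>
      intro g hn hg hgp h1 h2
      obtain ⟨w, hw, hmin⟩ := Finset.exists_min_image (A.filter fun x => g x ≠ t) key
        (Finset.card_pos.1 (by omega))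
      rw [Finset.mem_filter] at hw
      have hj := joined_update hS hg hgp (hA w hw.1) ht
        (hfree g hg hgp h1 h2 w hw.1 hw.2 fun x hx hx' => hmin x (Finset.mem_filter.2 ⟨hx, hx'⟩))
      refine hj.trans (ih _ ?_ (hg.update w ht) hj.isPlane ?_ ?_)
      · have : (A.filter fun x => Function.update g w t x ≠ t) =
            (A.filter fun x => g x ≠ t).erase w := by
          ext x
          simp only [Finset.mem_filter, Finset.mem_erase, Function.update_apply]
          split_ifs with hx <;> simp [hx]
        rw [this, Finset.card_erase_of_mem (Finset.mem_filter.2 hw), hn]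
        rfl
      · intro x hx
        rw [Function.update_of_ne (by rintro rfl; exact hx hw.1), h1 x hx]
      · intro x hx
        rw [Function.update_apply]
        split_ifs
        · exact .inr rfl
        · exact h2 x hx
  exact main _ f rfl h hpl (fun _ _ => rfl) fun _ _ => .inl rfl

end Moves

/-! ### Edges cannot leave a triangle through two of its sides. -/

section Sector

theorem le_or_le_of_mem_segment (φ : Plane →ᵃ[ℝ] ℝ) {a b z : Plane} (hz : z ∈ segment ℝ a b) :
    φ a ≤ φ z ∨ φ b ≤ φ z := by
  rw [segment_eq_image_lineMap] at hz
  obtain ⟨t, ⟨h0, h1⟩, rfl⟩ := hz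
  rw [AffineMap.apply_lineMap, AffineMap.lineMap_apply_ring']
  rcases le_total (φ a) (φ b) with h | h
  · exact .inl (by nlinarith)
  · exact .inr (by nlinarith)

theorem exists_mem_segment_eq_zero {α β : Plane →ᵃ[ℝ] ℝ} {z b : Plane} (hα : 0 < α z)
    (hβ : 0 < β z) (hz : α z + β z ≤ 1) (hb : α b + β b < 1) (hβb : β b ≤ 0) :
    ∃ y ∈ segment ℝ z b, α y + β y < 1 ∧ β y = 0 ∧ (0 ≤ α b → 0 ≤ α y) := by
  have hd : 0 < β z - β b := by linarith
  have ht : 0 < β z / (β z - β b) := div_pos hβ hd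
  have ht1 : β z / (β z - β b) ≤ 1 := (div_le_one hd).2 (by linarith)
  have hmul : β z / (β z - β b) * (β z - β b) = β z := div_mul_cancel₀ _ hd.ne'
  -- The parameter is the zero of the affine function `β` along the segment from `z` to `b`.
  refine ⟨AffineMap.lineMap z b (β z / (β z - β b)), ?_, ?_, ?_, fun hαb => ?_⟩
  · rw [segment_eq_image_lineMap]
    exact ⟨_, ⟨ht.le, ht1⟩, rfl⟩
  all_goals
    rw [AffineMap.apply_lineMap, AffineMap.lineMap_apply_ring']
    try rw [AffineMap.apply_lineMap, AffineMap.lineMap_apply_ring']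
    generalize β z / (β z - β b) = t at *
  · nlinarith
  · linarith
  · nlinarith

/-- A segment that leaves the triangle `0 < α`, `0 < β`, `α + β ≤ 1` and ends in `α + β < 1` meets
one of the sides on the coordinate axes. -/
theorem exists_exit {α β : Plane →ᵃ[ℝ] ℝ} {z b : Plane} (hα : 0 < α z) (hβ : 0 < β z)
    (hz : α z + β z ≤ 1) (hb : α b + β b < 1) (hnb : α b ≤ 0 ∨ β b ≤ 0) :
    ∃ y ∈ segment ℝ z b, α y + β y < 1 ∧ (α y = 0 ∧ 0 ≤ β y ∨ β y = 0 ∧ 0 ≤ α y) := by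
  have key : ∀ γ δ : Plane →ᵃ[ℝ] ℝ, 0 < γ z → 0 < δ z → γ z + δ z ≤ 1 → γ b + δ b < 1 → γ b ≤ 0 →
      ∃ y ∈ segment ℝ z b, γ y + δ y < 1 ∧ (γ y = 0 ∧ 0 ≤ δ y ∨ δ y = 0 ∧ 0 ≤ γ y) := by
    intro γ δ hγ hδ hz hb hγb
    obtain ⟨y, h1, h2, h3, -⟩ := exists_mem_segment_eq_zero hδ hγ (by linarith) (by linarith) hγb
    rcases le_total 0 (δ y) with hy | hy
    · exact ⟨y, h1, by linarith, .inl ⟨h3, hy⟩⟩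
    -- The axis `γ = 0` was met on its negative half, so the other axis is crossed earlier, between
    -- `z` and `y`.
    · obtain ⟨y', h1', h2', h3', h4'⟩ := exists_mem_segment_eq_zero hγ hδ hz (by linarith) hy
      exact ⟨y', (convex_segment z b).segment_subset (left_mem_segment ℝ z b) h1 h1', h2',
        .inr ⟨h3', h4' h3.ge⟩⟩
  rcases hnb with h | h
  · exact key α β hα hβ hz hb h
  · obtain ⟨y, h1, h2, h3⟩ := key β α hβ hα (by linarith) (by linarith) h
    exact ⟨y, h1, by linarith, h3.symm⟩

/-- Affine coordinates `α`, `β` with origin `p`, unit point `l` on the first axis, and the point `s`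
on the second axis beyond the unit point. -/
structure IsSector (α β : Plane →ᵃ[ℝ] ℝ) (p l s : Plane) : Prop where
  fst_p : α p = 0
  snd_p : β p = 0
  fst_l : α l = 1
  snd_l : β l = 0
  fst_s : α s = 0
  snd_s : 1 ≤ β s
  ext : ∀ x y, α x = α y → β x = β y → x = y

variable {α β : Plane →ᵃ[ℝ] ℝ} {S : Finset Plane}

theorem IsSector.mem_segment_l {p l s y : Plane} (h : IsSector α β p l s) (h0 : β y = 0)
    (h1 : 0 ≤ α y) (h2 : α y ≤ 1) : y ∈ segment ℝ p l := by
  rw [segment_eq_image_lineMap]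
  refine ⟨α y, ⟨h1, h2⟩, h.ext _ _ ?_ ?_⟩
  · simp [AffineMap.apply_lineMap, AffineMap.lineMap_apply_ring', h.fst_p, h.fst_l]
  · simp [AffineMap.apply_lineMap, h.snd_p, h.snd_l, h0]

theorem IsSector.mem_segment_s {p l s y : Plane} (h : IsSector α β p l s) (h0 : α y = 0)
    (h1 : 0 ≤ β y) (h2 : β y ≤ 1) : y ∈ segment ℝ p s := by
  have hs := h.snd_s
  rw [segment_eq_image_lineMap]
  refine ⟨β y / β s, ⟨by positivity, (div_le_one (by linarith)).2 (by linarith)⟩, h.ext _ _ ?_ ?_⟩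
  · simp [AffineMap.apply_lineMap, h.fst_p, h.fst_s, h0]
  · rw [AffineMap.apply_lineMap, AffineMap.lineMap_apply_ring', h.snd_p, sub_zero, add_zero,
      div_mul_cancel₀ _ (by linarith)]

/-- An edge cannot leave the sector through one of the edges that bound it. -/
theorem IsSector.not_exit {T : SimpleGraph S} (hT : IsPlane T) {p l s a b : S}
    (h : IsSector α β p l s) (hl : T.Adj p l) (hs : T.Adj p s) (hab : T.Adj a b) (hap : a ≠ p)
    (hbp : b ≠ p) {z : Plane} (hz : z ∈ segment ℝ (a : Plane) b) (hα : 0 < α z) (hβ : 0 < β z)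
    (hz1 : α z + β z ≤ 1) (hb : α b + β b < 1) (hnb : α b ≤ 0 ∨ β b ≤ 0) : False := by
  obtain ⟨y, hy, hy1, hy2⟩ := exists_exit hα hβ hz1 hb hnb
  have hyab : y ∈ segment ℝ (a : Plane) b :=
    (convex_segment _ _).segment_subset hz (right_mem_segment ℝ _ _) hy
  have hno : ∀ q : S, T.Adj p q → y ∈ segment ℝ (p : Plane) q → 1 ≤ α q + β q → False := by
    intro q hpq hyq hq
    have hne : s(a, b) ≠ s(p, q) := by
      intro e
      rcases Sym2.eq_iff.1 e with ⟨e, -⟩ | ⟨-, e⟩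
      · exact hap e
      · exact hbp e
    obtain ⟨v, hv, hv', rfl⟩ := hT s(a, b) hab s(p, q) hpq hne
      ⟨by rwa [edgeSegment_mk], by rwa [edgeSegment_mk]⟩
    rw [Sym2.mem_iff] at hv hv'
    rcases hv' with rfl | rfl
    · rcases hv with rfl | rfl
      · exact hap rfl
      · exact hbp rfl
    · linarith
  rcases hy2 with ⟨h0, h1⟩ | ⟨h0, h1⟩
  · exact hno s hs (h.mem_segment_s h0 h1 (by linarith)) (by linarith [h.fst_s, h.snd_s])
  · exact hno l hl (h.mem_segment_l h0 h1 (by linarith)) (by linarith [h.fst_l, h.snd_l])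

/-- Some endpoint of the edge has `α + β` at most that of `z`. By `not_exit` this endpoint cannot
lie outside the triangle, so it is an interior vertex, which `hV` forbids. -/
theorem IsSector.not_cross {T : SimpleGraph S} (hT : IsPlane T) {p l s a b : S}
    (h : IsSector α β p l s) (hl : T.Adj p l) (hs : T.Adj p s) (hab : T.Adj a b) (hap : a ≠ p)
    (hbp : b ≠ p) {z : Plane} (hz : z ∈ segment ℝ (a : Plane) b) (hα : 0 < α z) (hβ : 0 < β z)
    (hz1 : α z + β z < 1)
    (hV : ∀ c d : S, T.Adj c d → (c = a ∧ d = b ∨ c = b ∧ d = a) → α c + β c ≤ α z + β z →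
      0 < α c → 0 < β c → False) : False := by
  rcases le_or_le_of_mem_segment (α + β) hz with hc | hc
  · have hc' : α a + β a ≤ α z + β z := hc
    refine h.not_exit hT hl hs hab.symm hbp hap (segment_symm ℝ (a : Plane) b ▸ hz) hα hβ hz1.le
      (by linarith) ?_
    by_contra! hn
    exact hV a b hab (.inl ⟨rfl, rfl⟩) hc' hn.1 hn.2
  · have hc' : α b + β b ≤ α z + β z := hc
    refine h.not_exit hT hl hs hab hap hbp hz hα hβ hz1.le (by linarith) ?_
    by_contra! hn
    exact hV b a hab.symm (.inr ⟨rfl, rfl⟩) hc' hn.1 hn.2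

theorem adj_head {P : List S} {p s a : S} {Q : List S} {g : S → S} (hP : P = p :: s :: Q)
    (h : IsSkeleton P g) (ha : (pathAttach P g).Adj p a) : a = s ∨ (a ∉ P ∧ g a = p) := by
  subst hP
  have hp : p ∉ s :: Q := (List.nodup_cons.1 h.nodup).1
  rcases (pathAttach_adj.1 ha).2 with (h1 | h1) | (h1 | h1)
  · rcases pair_infix_cons_cons.1 h1 with h2 | h2
    · exact .inl h2.2
    · exact absurd (left_mem_of_pair_infix h2) hp
  · exact absurd List.mem_cons_self h1.1
  · rcases pair_infix_cons_cons.1 h1 with h2 | h2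
    · exact absurd (h2.2 ▸ List.mem_cons_self) hp
    · exact absurd (right_mem_of_pair_infix h2) hp
  · exact .inr h1

end Sector

/-! ### Emptying the triangle and moving its corner. -/

section Shrink

variable {α β : Plane →ᵃ[ℝ] ℝ} {S : Finset Plane}

theorem pos_of_mem_segment_origin {φ : Plane →ᵃ[ℝ] ℝ} {p a : Plane} (hp : φ p = 0) {t : ℝ}
    (ht : 0 ≤ t) (h : 0 < φ (AffineMap.lineMap p a t)) : 0 < φ a := by
  rw [AffineMap.apply_lineMap, AffineMap.lineMap_apply_ring', hp, sub_zero, add_zero] at h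
  exact pos_of_mul_pos_right h ht

open Classical in
/-- The vertices in the sector can be reattached to its apex `p`, nearest ones first. -/
theorem IsSector.joined_apex (hS : InGeneralPosition S) {P Q : List S} {p s l : S} {f : S → S}
    (hP : P = p :: s :: Q) (h : IsSkeleton P f) (hpl : IsPlane (pathAttach P f)) (hl : l ∉ P)
    (hfl : f l = p) (hsec : IsSector α β p l s) (A : Finset S)
    (hA : ∀ x : S, x ∈ A ↔ 0 < α x ∧ 0 < β x ∧ α x + β x < 1) (hAP : ∀ x ∈ A, x ∉ P) :
    IsSkeleton P (fun x => if x ∈ A then p else f x) ∧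
      Joined (pathAttach P f) (pathAttach P fun x => if x ∈ A then p else f x) := by
  have hlA : l ∉ A := by simp [hA, hsec.snd_l]
  refine joined_reattach hS h hpl A hAP (by simp [hP]) (fun x => α x + β x) ?_
  intro g hg hgp hg1 hg2 w hw hwp hmin a b hab haw hap hbw hbp z hz hz'
  obtain ⟨hw1, hw2, hw3⟩ := (hA w).1 hw
  rw [openSegment_eq_image_lineMap] at hz
  obtain ⟨t, ⟨ht0, ht1⟩, rfl⟩ := hz
  have e1 : α (AffineMap.lineMap (w : Plane) (p : Plane) t) = (1 - t) * α w := by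
    rw [AffineMap.apply_lineMap, AffineMap.lineMap_apply_ring', hsec.fst_p]; ring
  have e2 : β (AffineMap.lineMap (w : Plane) (p : Plane) t) = (1 - t) * β w := by
    rw [AffineMap.apply_lineMap, AffineMap.lineMap_apply_ring', hsec.snd_p]; ring
  have ht : 0 < 1 - t := by linarith
  have hpl' : (pathAttach P g).Adj p l := by
    have := pathAttach_adj_attach hg hl
    rw [hg1 l hlA, hfl] at this
    exact this.symm
  have hps : (pathAttach P g).Adj p s := by
    apply pathAttach_adj_of_pair_infix hg.nodup
    rw [hP]
    exact pair_infix_cons_cons.2 (.inl ⟨rfl, rfl⟩)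
  refine hsec.not_cross hgp hpl' hps hab hap hbp hz' (e1 ▸ mul_pos ht hw1) (e2 ▸ mul_pos ht hw2)
    (by rw [e1, e2]; nlinarith) ?_
  -- The point on the segment from `w` to `p` has smaller `α + β` than `w`, so `c` is a vertex of
  -- `A` not attached to `p` with a smaller key than `w`.
  intro c d hcd hcd' hc1 hc2 hc3
  rw [e1, e2] at hc1
  have hcA : c ∈ A := (hA c).2 ⟨hc2, hc3, by nlinarith⟩
  have hd : d = g c := pathAttach_adj_of_notMem hg (hAP c hcA) hcd
  have hdp : d ≠ p := by
    rcases hcd' with ⟨-, rfl⟩ | ⟨-, rfl⟩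
    · exact hbp
    · exact hap
  have hk := hmin c hcA (hd ▸ hdp)
  nlinarith

/-- An edge at the apex that meets the sector is attached to a vertex of the sector. -/
theorem IsSector.apex_edge {P Q : List S} {p s l : S} {g : S → S}
    (hP : P = p :: s :: Q) (hg : IsSkeleton P g) (hsec : IsSector α β p l s) {a : S}
    (ha : (pathAttach P g).Adj p a) {z : Plane} (hz : z ∈ segment ℝ (p : Plane) a)
    (hα : 0 < α z) (hβ : 0 < β z) :
    a ∉ P ∧ g a = p ∧ 0 < α a ∧ 0 < β a ∧ ∃ t : ℝ, 0 < t ∧ α z = t * α a ∧ β z = t * β a := by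
  rw [segment_eq_image_lineMap] at hz
  obtain ⟨t, ⟨ht0, -⟩, rfl⟩ := hz
  have h1 := pos_of_mem_segment_origin hsec.fst_p ht0 hα
  have h2 := pos_of_mem_segment_origin hsec.snd_p ht0 hβ
  have e1 : α (AffineMap.lineMap (p : Plane) (a : Plane) t) = t * α a := by
    rw [AffineMap.apply_lineMap, AffineMap.lineMap_apply_ring', hsec.fst_p]; ring
  have e2 : β (AffineMap.lineMap (p : Plane) (a : Plane) t) = t * β a := by
    rw [AffineMap.apply_lineMap, AffineMap.lineMap_apply_ring', hsec.snd_p]; ring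
  have ht : 0 < t := lt_of_le_of_ne ht0 (by rintro rfl; rw [e1, zero_mul] at hα; exact hα.false)
  rcases adj_head hP hg ha with rfl | h3
  · exact absurd hsec.fst_s h1.ne'
  · exact ⟨h3.1, h3.2, h1, h2, t, ht, e1, e2⟩

open Classical in
/-- Vertices of the sector that are attached to its apex `p` can be reattached to a path vertex `u`
on the third side, in the order of their angular distance from `u`. -/
theorem IsSector.joined_base (hS : InGeneralPosition S) {P Q : List S} {p s l u : S} {f : S → S}
    (hP : P = p :: s :: Q) (h : IsSkeleton P f) (hpl : IsPlane (pathAttach P f)) (hl : l ∉ P)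
    (hfl : f l = p) (hsec : IsSector α β p l s) (A : Finset S)
    (hA : ∀ x : S, x ∈ A ↔ 0 < α x ∧ 0 < β x ∧ α x + β x < 1) (hAP : ∀ x ∈ A, x ∉ P)
    (hfA : ∀ x ∈ A, f x = p) (hu : u ∈ P) (hu0 : 0 ≤ α u) (hu1 : 0 < β u) (hu2 : α u + β u = 1)
    (hcone : ∀ x : S, x ∉ A → x ∉ P → f x = p → 0 < α x → 0 < β x → False) :
    IsSkeleton P (fun x => if x ∈ A then u else f x) ∧
      Joined (pathAttach P f) (pathAttach P fun x => if x ∈ A then u else f x) := by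
  have hlA : l ∉ A := by simp [hA, hsec.snd_l]
  -- The radial projection of `x` from `p` to the line `α + β = 1` has first coordinate `α x / (α x
  -- + β x)`; the key is the distance of this coordinate from `α u`. It is constant along rays from
  -- `p`.
  refine joined_reattach hS h hpl A hAP hu (fun x => |α x - α u * (α x + β x)| / (α x + β x)) ?_
  intro g hg hgp hg1 hg2 w hw hwu hmin a b hab haw hau hbw hbu z hz hz'
  obtain ⟨hw1, hw2, hw3⟩ := (hA w).1 hw
  have hup : u ≠ p := by rintro rfl; exact hu1.ne' hsec.snd_p
  have hwP := hAP w hw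
  have hwp : w ≠ p := by rintro rfl; exact hwP (by simp [hP])
  have hwu' : w ≠ u := by rintro rfl; exact hwP hu
  rw [openSegment_eq_image_lineMap] at hz
  obtain ⟨t, ⟨ht0, ht1⟩, rfl⟩ := hz
  set z := AffineMap.lineMap (w : Plane) (u : Plane) t with hzdef
  have e1 : α z = (1 - t) * α w + t * α u := by
    rw [hzdef, AffineMap.apply_lineMap, AffineMap.lineMap_apply_ring']; ring
  have e2 : β z = (1 - t) * β w + t * β u := by
    rw [hzdef, AffineMap.apply_lineMap, AffineMap.lineMap_apply_ring']; ring
  have ht : 0 < 1 - t := by linarith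
  have hz1 : 0 < α z := by rw [e1]; positivity
  have hz2 : 0 < β z := by rw [e2]; positivity
  have hz3 : α z + β z = (1 - t) * (α w + β w) + t := by rw [e1, e2]; linear_combination t * hu2
  have hapex : ∀ c : S, (pathAttach P g).Adj p c → z ∈ segment ℝ (p : Plane) c → c ≠ u → False := by
    intro c hc hzc hcu
    obtain ⟨hcP, hgc, hc1, hc2, r, hr, er1, er2⟩ := hsec.apex_edge hP hg hc hzc hz1 hz2
    by_cases hcA : c ∈ A
    · have hk := hmin c hcA (by rw [hgc]; exact hup.symm)
      -- Vanishing would put `w` on the line `pu`.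
      have hγ : α w - α u * (α w + β w) ≠ 0 := by
        intro hγ
        apply hS.not_collinear hup.symm hwp.symm hwu'.symm
        have : (w : Plane) = AffineMap.lineMap (p : Plane) (u : Plane) (α w + β w) := by
          apply hsec.ext
          · rw [AffineMap.apply_lineMap, AffineMap.lineMap_apply_ring', hsec.fst_p]; linarith
          · rw [AffineMap.apply_lineMap, AffineMap.lineMap_apply_ring', hsec.snd_p]
            linear_combination -hγ - (α w + β w) * hu2
        rw [this]
        exact collinear_lineMap _ _ _
      have hcz : |α c - α u * (α c + β c)| / (α c + β c) =
          |α z - α u * (α z + β z)| / (α z + β z) := by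
        rw [er1, er2, show r * α c - α u * (r * α c + r * β c) =
          r * (α c - α u * (α c + β c)) by ring, abs_mul, abs_of_pos hr, ← mul_add,
          mul_div_mul_left _ _ hr.ne']
      -- Moving from `w` towards `u` strictly decreases the key, while `c` and `z` have equal keys
      -- as they lie on one ray from `p`. This contradicts the minimality of `w`.
      have hzw : α z - α u * (α z + β z) = (1 - t) * (α w - α u * (α w + β w)) := by
        rw [hz3, e1]; ring
      rw [hcz, hzw, hz3, abs_mul, abs_of_pos ht] at hk
      rw [div_le_div_iff₀ (by positivity) (by positivity)] at hk
      nlinarith [mul_pos (abs_pos.2 hγ) ht0]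
    · exact hcone c hcA hcP (hg1 c hcA ▸ hgc) hc1 hc2
  by_cases hap : a = p
  · subst hap
    exact hapex b hab hz' hbu
  by_cases hbp : b = p
  · subst hbp
    exact hapex a hab.symm (segment_symm ℝ (a : Plane) b ▸ hz') hau
  have hpl' : (pathAttach P g).Adj p l := by
    have := pathAttach_adj_attach hg hl
    rw [hg1 l hlA, hfl] at this
    exact this.symm
  have hps : (pathAttach P g).Adj p s := by
    apply pathAttach_adj_of_pair_infix hg.nodup
    rw [hP]
    exact pair_infix_cons_cons.2 (.inl ⟨rfl, rfl⟩)
  refine hsec.not_cross hgp hpl' hps hab hap hbp hz' hz1 hz2 (by rw [hz3]; nlinarith) ?_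
  intro c d hcd hcd' hc1 hc2 hc3
  have hcA : c ∈ A := (hA c).2 ⟨hc2, hc3, by nlinarith⟩
  have hd : d = g c := pathAttach_adj_of_notMem hg (hAP c hcA) hcd
  rcases hg2 c hcA with h1 | h1
  · rw [hfA c hcA] at h1
    grind
  · grind

/-- Once the sector only contains vertices attached to `u`, its corner `l` can be reattached to `u`,
too. -/
theorem IsSector.isFree_corner (hS : InGeneralPosition S) {P Q : List S} {p s l u : S} {g : S → S}
    (hP : P = p :: s :: Q) (hg : IsSkeleton P g) (hgp : IsPlane (pathAttach P g)) (hl : l ∉ P)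
    (hgl : g l = p) (hsec : IsSector α β p l s) (A : Finset S)
    (hA : ∀ x : S, x ∈ A ↔ 0 < α x ∧ 0 < β x ∧ α x + β x < 1) (hAP : ∀ x ∈ A, x ∉ P)
    (hgA : ∀ x ∈ A, g x = u) (hu : u ∈ P) (hu0 : 0 ≤ α u) (hu1 : 0 < β u) (hu2 : α u + β u = 1)
    (hcone : ∀ x : S, x ∉ A → x ∉ P → g x = p → 0 < α x → 0 < β x → False) :
    IsFree (pathAttach P g) l u := by
  intro a b hab hal hau hbl hbu z hz hz'
  have hup : u ≠ p := by rintro rfl; exact hu1.ne' hsec.snd_p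
  have hlu : l ≠ u := by rintro rfl; exact hl hu
  rw [openSegment_eq_image_lineMap] at hz
  obtain ⟨t, ⟨ht0, ht1⟩, rfl⟩ := hz
  set z := AffineMap.lineMap (l : Plane) (u : Plane) t with hzdef
  have e1 : α z = (1 - t) + t * α u := by
    rw [hzdef, AffineMap.apply_lineMap, AffineMap.lineMap_apply_ring', hsec.fst_l]; ring
  have e2 : β z = t * β u := by
    rw [hzdef, AffineMap.apply_lineMap, AffineMap.lineMap_apply_ring', hsec.snd_l]; ring
  have ht : 0 < 1 - t := by linarith
  have hz1 : 0 < α z := by rw [e1]; positivity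
  have hz2 : 0 < β z := by rw [e2]; positivity
  have hz3 : α z + β z = 1 := by rw [e1, e2]; linear_combination t * hu2
  have hapex : ∀ c : S, (pathAttach P g).Adj p c → z ∈ segment ℝ (p : Plane) c → False := by
    intro c hc hzc
    obtain ⟨hcP, hgc, hc1, hc2, -⟩ := hsec.apex_edge hP hg hc hzc hz1 hz2
    by_cases hcA : c ∈ A
    · exact hup ((hgA c hcA).symm.trans hgc)
    · exact hcone c hcA hcP hgc hc1 hc2
  by_cases hap : a = p
  · subst hap
    exact hapex b hab hz'
  by_cases hbp : b = p
  · subst hbp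
    exact hapex a hab.symm (segment_symm ℝ (a : Plane) b ▸ hz')
  have hpl' : (pathAttach P g).Adj p l := hgl ▸ (pathAttach_adj_attach hg hl).symm
  have hps : (pathAttach P g).Adj p s := by
    apply pathAttach_adj_of_pair_infix hg.nodup
    rw [hP]
    exact pair_infix_cons_cons.2 (.inl ⟨rfl, rfl⟩)
  -- Here `z` lies on the line `α + β = 1` itself, so `not_cross` does not apply; general position
  -- supplies the strict inequality at an endpoint.
  have hline : ∀ c : S, c ≠ l → c ≠ u → α c + β c ≠ 1 := by
    intro c hcl hcu hc
    apply hS.not_collinear hlu hcl.symm hcu.symm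
    have : (c : Plane) = AffineMap.lineMap (l : Plane) (u : Plane) (β c / β u) := by
      have hdiv : β c / β u * β u = β c := div_mul_cancel₀ _ hu1.ne'
      apply hsec.ext
      · rw [AffineMap.apply_lineMap, AffineMap.lineMap_apply_ring', hsec.fst_l]
        linear_combination hc - β c / β u * hu2 + hdiv
      · rw [AffineMap.apply_lineMap, AffineMap.lineMap_apply_ring', hsec.snd_l]; linarith
    rw [this]
    exact collinear_lineMap _ _ _
  have hA' : ∀ c d : S, (pathAttach P g).Adj c d → d ≠ u → α c + β c < 1 → α c ≤ 0 ∨ β c ≤ 0 := by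
    intro c d hcd hdu hc
    by_contra! hn
    have hcA : c ∈ A := (hA c).2 ⟨hn.1, hn.2, hc⟩
    exact hdu ((pathAttach_adj_of_notMem hg (hAP c hcA) hcd).trans (hgA c hcA))
  rcases le_or_le_of_mem_segment (α + β) hz' with hc | hc
  · have hc' : α a + β a < 1 := lt_of_le_of_ne (hz3 ▸ hc) (hline a hal hau)
    exact hsec.not_exit hgp hpl' hps hab.symm hbp hap (segment_symm ℝ (a : Plane) b ▸ hz') hz1 hz2
      hz3.le hc' (hA' a b hab hbu hc')
  · have hc' : α b + β b < 1 := lt_of_le_of_ne (hz3 ▸ hc) (hline b hbl hbu)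
    exact hsec.not_exit hgp hpl' hps hab hap hbp hz' hz1 hz2 hz3.le hc' (hA' b a hab.symm hau hc')

/-- Vertices inside the triangle may be attached to path vertices beyond the side `lu` and thus
block it. Collecting them at `p` removes these edges, and passing them on to `u` ensures that `p`
gains no attached vertex in the end. -/
theorem IsSector.exists_joined (hS : InGeneralPosition S) {P Q : List S} {p s l u : S} {f : S → S}
    (hP : P = p :: s :: Q) (h : IsSkeleton P f) (hpl : IsPlane (pathAttach P f)) (hl : l ∉ P)
    (hfl : f l = p) (hsec : IsSector α β p l s)
    (hV : ∀ x ∈ P, 0 < α x → 0 < β x → 1 ≤ α x + β x)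
    (hu : u ∈ P) (hu0 : 0 ≤ α u) (hu1 : 0 < β u) (hu2 : α u + β u = 1)
    (hcone : ∀ x : S, x ∉ P → f x = p → 0 < α x → 0 < β x → False) :
    ∃ f', IsSkeleton P f' ∧ Joined (pathAttach P f) (pathAttach P f') ∧ f' l ≠ p ∧
      ∀ x, f' x = p → f x = p := by
  classical
  let A : Finset S := Finset.univ.filter fun x => 0 < α x ∧ 0 < β x ∧ α x + β x < 1
  have hA : ∀ x : S, x ∈ A ↔ 0 < α x ∧ 0 < β x ∧ α x + β x < 1 := fun x => by simp [A]
  have hAP : ∀ x ∈ A, x ∉ P := fun x hx hxP => by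
    obtain ⟨h1, h2, h3⟩ := (hA x).1 hx
    linarith [hV x hxP h1 h2]
  have hlA : l ∉ A := by simp [hA, hsec.snd_l]
  have hup : u ≠ p := by rintro rfl; exact hu1.ne' hsec.snd_p
  obtain ⟨k1, j1⟩ := hsec.joined_apex hS hP h hpl hl hfl A hA hAP
  set f₁ : S → S := fun x => if x ∈ A then p else f x with hf₁
  obtain ⟨k2, j2⟩ := hsec.joined_base (u := u) hS hP k1 j1.isPlane hl (by simp [hf₁, hlA, hfl]) A hA
    hAP (fun x hx => by simp [hf₁, hx]) hu hu0 hu1 hu2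
    (fun x hx hxP hfx => hcone x hxP (by simpa [hf₁, hx] using hfx))
  set f₂ : S → S := fun x => if x ∈ A then u else f₁ x with hf₂
  have j3 := joined_update hS k2 j2.isPlane hl hu <|
    hsec.isFree_corner hS hP k2 j2.isPlane hl (by simp [hf₂, hf₁, hlA, hfl]) A hA hAP
      (fun x hx => by simp [hf₂, hx]) hu hu0 hu1 hu2
      (fun x hx hxP hfx => hcone x hxP (by simpa [hf₂, hf₁, hx] using hfx))
  refine ⟨_, k2.update l hu, (j1.trans j2).trans j3, by simpa using hup, fun x hx => ?_⟩
  by_cases hxl : x = l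
  · rw [hxl, hfl]
  · rw [Function.update_of_ne hxl] at hx
    by_cases hxA : x ∈ A
    · simp [hf₂, hxA, hup] at hx
    · simpa [hf₂, hf₁, hxA] using hx

end Shrink

/-! ### Freeing the first path vertex, reaching stars, and the conclusion. -/

section Connectivity

variable {S : Finset Plane}

/-- Used to compare the coordinates based on the initial vertex `l₀` with those based on the
extremal vertex `l`. -/
theorem apply_eq_of_coordinates {α β φ : Plane →ᵃ[ℝ] ℝ} {p l s : Plane} (hαp : α p = 0)
    (hβp : β p = 0) (hαl : α l = 1) (hβl : β l = 0) (hαs : α s = 0) (hβs : β s = 1)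
    (hext : ∀ x y, α x = α y → β x = β y → x = y) (hφ : φ p = 0) (x : Plane) :
    φ x = α x * φ l + β x * φ s := by
  have key : ∀ ψ : Plane →ᵃ[ℝ] ℝ, ψ p = 0 →
      ψ ((α x • (l -ᵥ p) + β x • (s -ᵥ p)) +ᵥ p) = α x * ψ l + β x * ψ s := by
    intro ψ hψ
    rw [AffineMap.map_vadd, map_add, map_smul, map_smul, AffineMap.linearMap_vsub,
      AffineMap.linearMap_vsub, hψ]
    simp
  rw [← key φ hφ]
  congr 1
  refine hext _ _ ?_ ?_
  · rw [key α hαp, hαl, hαs]; ring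
  · rw [key β hβp, hβl, hβs]; ring

theorem exists_joined_fewer (hS : InGeneralPosition S) {P Q : List S} {p s : S} {f : S → S}
    (hP : P = p :: s :: Q) (h : IsSkeleton P f) (hpl : IsPlane (pathAttach P f)) {l₀ : S}
    (hl₀ : l₀ ∉ P) (hfl₀ : f l₀ = p) :
    ∃ f', IsSkeleton P f' ∧ Joined (pathAttach P f) (pathAttach P f') ∧
      (∃ l, l ∉ P ∧ f l = p ∧ f' l ≠ p) ∧ ∀ x, f' x = p → f x = p := by
  classical
  have hpP : p ∈ P := by simp [hP]
  have hsP : s ∈ P := by simp [hP]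
  have hps : p ≠ s := by
    have := h.nodup
    rw [hP] at this
    rintro rfl
    simp at this
  have hncol : ∀ x : S, x ∉ P → ¬ Collinear ℝ {(p : Plane), (x : Plane), (s : Plane)} :=
    fun x hx => hS.not_collinear (fun e => hx (e ▸ hpP)) hps fun e => hx (e ▸ hsP)
  obtain ⟨a, b, hap, hbp, hal, -, has, hbs, -⟩ := exists_affine_coordinates (hncol l₀ hl₀)
  -- Maximal slope `b / a` means angularly closest to the ray `ps` on the side of `l₀`; hence no
  -- vertex attached to `p` lies in the open cone between `pl` and `ps`.
  obtain ⟨l, hl, hmax⟩ := Finset.exists_max_image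
    (Finset.univ.filter fun x : S => x ∉ P ∧ f x = p ∧ 0 < a x) (fun x => b x / a x)
    ⟨l₀, by simp [hl₀, hfl₀, hal]⟩
  simp only [Finset.mem_filter, Finset.mem_univ, true_and] at hl hmax
  obtain ⟨hlP, hfl, hla⟩ := hl
  obtain ⟨α, γ, hαp, hγp, hαl, hγl, hαs, hγs, hext⟩ := exists_affine_coordinates (hncol l hlP)
  have hcone : ∀ x : S, x ∉ P → f x = p → 0 < α x → 0 < γ x → False := by
    intro x hxP hfx hx1 hx2
    have ea := apply_eq_of_coordinates hαp hγp hαl hγl hαs hγs hext hap x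
    have eb := apply_eq_of_coordinates hαp hγp hαl hγl hαs hγs hext hbp x
    rw [has, mul_zero, add_zero] at ea
    rw [hbs, mul_one] at eb
    have hxa : 0 < a x := ea ▸ mul_pos hx1 hla
    have hle := hmax x ⟨hxP, hfx, hxa⟩
    rw [div_le_div_iff₀ hxa hla, ea, eb] at hle
    nlinarith [mul_pos hx2 hla]
  -- The quotient `γ / (1 - α)` measures the angle at `l` from the side `lp`. The candidates include
  -- `s`, so a minimiser exists and its value `t` is at most 1.
  obtain ⟨u, hu, hmin⟩ := Finset.exists_min_image
    (P.toFinset.filter fun x : S => 0 ≤ α x ∧ 0 < γ x ∧ α x + γ x ≤ 1) (fun x => γ x / (1 - α x))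
    ⟨s, by simp [hsP, hαs, hγs]⟩
  simp only [Finset.mem_filter, List.mem_toFinset] at hu hmin
  obtain ⟨huP, hu0, hu1, hu2⟩ := hu
  set t : ℝ := γ u / (1 - α u) with ht
  have hu3 : 0 < 1 - α u := by linarith
  have ht0 : 0 < t := div_pos hu1 hu3
  have ht1 : t ≤ 1 := (div_le_one hu3).2 (by linarith)
  have hut : t * (1 - α u) = γ u := div_mul_cancel₀ _ hu3.ne'
  have hβ : ∀ x, (t⁻¹ • γ) x = t⁻¹ * γ x := fun x => rfl
  have hti : t⁻¹ * t = 1 := inv_mul_cancel₀ ht0.ne'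
  have hti0 : 0 < t⁻¹ := inv_pos.2 ht0
  -- Dividing `γ` by `t` turns the line `lu` into `α + β = 1`. Since `t ≤ 1`, the point `s` is at or
  -- beyond the unit point, so the second side of the triangle lies on the edge `ps`.
  have hsec : IsSector α (t⁻¹ • γ) (p : Plane) l s := by
    refine ⟨hαp, by simp [hβ, hγp], hαl, by simp [hβ, hγl], hαs, ?_, fun x y h1 h2 => ?_⟩
    · rw [hβ, hγs, mul_one]; exact (one_le_inv₀ ht0).2 ht1
    · exact hext x y h1 (mul_left_cancel₀ hti0.ne' h2)
  have hV : ∀ x ∈ P, 0 < α x → 0 < (t⁻¹ • γ) x → 1 ≤ α x + (t⁻¹ • γ) x := by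
    intro x hx hx1 hx2
    rw [hβ] at hx2 ⊢
    have hx3 : 0 < γ x := pos_of_mul_pos_right hx2 hti0.le
    by_contra! hlt
    have hlt' : γ x < t * (1 - α x) := by
      have : t * (t⁻¹ * γ x) = γ x := by rw [← mul_assoc, mul_comm t, hti, one_mul]
      nlinarith
    have hx4 : 0 < 1 - α x := pos_of_mul_pos_right (hx3.trans hlt') ht0.le
    have := hmin x ⟨hx, hx1.le, hx3, by nlinarith⟩
    rw [le_div_iff₀ hx4] at this
    linarith
  obtain ⟨f', h1, h2, h3, h4⟩ := hsec.exists_joined (u := u) hS hP h hpl hlP hfl hV huP hu0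
    (by rw [hβ]; positivity) (by rw [hβ, ← hut, ← mul_assoc, hti]; ring)
    (fun x hxP hfx hx1 hx2 => hcone x hxP hfx hx1 (pos_of_mul_pos_right (hβ x ▸ hx2) hti0.le))
  exact ⟨f', h1, h2, ⟨l, hlP, hfl, h3⟩, h4⟩

/-- All vertices attached to the first path vertex can be reattached to other path vertices. -/
theorem exists_joined_no_leaf (hS : InGeneralPosition S) {P Q : List S} {p s : S} {f : S → S}
    (hP : P = p :: s :: Q) (h : IsSkeleton P f) (hpl : IsPlane (pathAttach P f)) :
    ∃ f', IsSkeleton P f' ∧ Joined (pathAttach P f) (pathAttach P f') ∧ ∀ x, x ∉ P → f' x ≠ p := by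
  classical
  induction hn : (Finset.univ.filter fun x : S => x ∉ P ∧ f x = p).card using
    Nat.strong_induction_on generalizing f with
  | _ n ih =>
    by_cases hl : ∃ l, l ∉ P ∧ f l = p
    · obtain ⟨l₀, hl₀, hfl₀⟩ := hl
      obtain ⟨f', h', hj, ⟨l, hl, hfl, hfl'⟩, hsub⟩ := exists_joined_fewer hS hP h hpl hl₀ hfl₀
      obtain ⟨g, hg, hj', hgp⟩ := ih _ (by
        rw [← hn]
        refine Finset.card_lt_card ⟨fun x hx => ?_, fun hle => ?_⟩
        · simp only [Finset.mem_filter, Finset.mem_univ, true_and] at hx ⊢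
          exact ⟨hx.1, hsub x hx.2⟩
        · have := hle (Finset.mem_filter.2 ⟨Finset.mem_univ l, hl, hfl⟩)
          simp only [Finset.mem_filter, Finset.mem_univ, true_and] at this
          exact hfl' this.2) h' hj.isPlane rfl
      exact ⟨g, hg, hj.trans hj', hgp⟩
    · push Not at hl
      exact ⟨f, h, .refl ⟨hpl, pathAttach_isCaterpillar h⟩, hl⟩

/-- Every plane caterpillar is joined to the star at the last vertex of its path. -/
theorem joined_star (hS : InGeneralPosition S) {P : List S} {f : S → S} (h : IsSkeleton P f)
    (hpl : IsPlane (pathAttach P f)) :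
    Joined (pathAttach P f) (pathAttach [P.getLast h.ne_nil] fun _ => P.getLast h.ne_nil) := by
  classical
  induction P generalizing f with
  | nil => exact absurd rfl h.ne_nil
  | cons p R ih =>
    cases R with
    | nil =>
      have : pathAttach [p] f = pathAttach [p] fun _ => p :=
        pathAttach_congr fun v hv => by simpa using h.mem v hv
      rw [List.getLast_singleton, ← this]
      exact .refl ⟨hpl, pathAttach_isCaterpillar h⟩
    | cons s Q =>
      obtain ⟨g, hg, hj, hgp⟩ := exists_joined_no_leaf hS rfl h hpl
      obtain ⟨h1, h2⟩ := pathAttach_cons_cons hg hgp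
      have := ih h1 (h2 ▸ hj.isPlane)
      rw [h2] at this
      simpa using hj.trans this

theorem isSkeleton_star (r : S) : IsSkeleton [r] fun _ => r :=
  ⟨by simp, by simp, by simp⟩

theorem isPlane_star (hS : InGeneralPosition S) (r : S) : IsPlane (pathAttach [r] fun _ => r) := by
  have hmem : ∀ e ∈ (pathAttach [r] fun _ => r).edgeSet, r ∈ e := by
    intro e
    induction e using Sym2.ind with
    | _ a b =>
      intro he
      rw [SimpleGraph.mem_edgeSet, pathAttach_adj] at he
      rw [Sym2.mem_iff]
      rcases he.2 with (h | h) | (h | h)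
      · exact absurd h not_pair_infix_singleton
      · exact .inr h.2
      · exact absurd h not_pair_infix_singleton
      · exact .inl h.2
  intro e he e' he' hne
  exact hS.nonCrossing_of_mem (SimpleGraph.not_isDiag_of_mem_edgeSet _ he)
    (SimpleGraph.not_isDiag_of_mem_edgeSet _ he') hne (hmem e he) (hmem e' he')

theorem joined_star_star (hS : InGeneralPosition S) (r q : S) :
    Joined (pathAttach [r] fun _ => r) (pathAttach [q] fun _ => q) := by
  classical
  by_cases hrq : r = q
  · subst hrq
    exact .refl ⟨isPlane_star hS r, pathAttach_isCaterpillar (isSkeleton_star r)⟩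
  -- Peeling `q` off the path `[q, r]` identifies this graph with the star at `r`; read backwards,
  -- the path ends at `q`, so `joined_star` leads to the star at `q`.
  have hk : IsSkeleton [q, r] fun _ => r := ⟨by simpa using Ne.symm hrq, by simp, by simp⟩
  obtain ⟨-, h2⟩ := pathAttach_cons_cons hk fun v hv => hrq
  have h3 : pathAttach [q, r] (fun _ => r) = pathAttach [r] fun _ => r :=
    h2.symm.trans (pathAttach_congr fun v _ => by simp [Function.update_apply])
  have h4 : pathAttach [r, q] (fun _ => r) = pathAttach [r] fun _ => r := by
    rw [← h3, ← pathAttach_reverse]; rfl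
  have hk' : IsSkeleton [r, q] fun _ => r := hk.reverse
  have := joined_star hS hk' (h4 ▸ isPlane_star hS r)
  rw [h4] at this
  simpa using this

theorem rotationGraph_connected (hne : S.Nonempty) (hS : InGeneralPosition S) :
    (rotationGraph S).Connected := by
  obtain ⟨q, hq⟩ := hne
  have hstar := And.intro (isPlane_star hS ⟨q, hq⟩)
    (pathAttach_isCaterpillar (isSkeleton_star (S := S) ⟨q, hq⟩))
  refine (SimpleGraph.connected_iff_exists_forall_reachable _).2 ⟨⟨_, hstar⟩, ?_⟩
  rintro ⟨T, hT, hT'⟩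
  obtain ⟨P, f, h, rfl⟩ := hT'.exists_eq_pathAttach
  obtain ⟨_, _, hr⟩ := (joined_star hS h hT).trans (joined_star_star hS _ ⟨q, hq⟩)
  exact hr.symm

theorem IsRotation.isCompatibleFlip (hS : InGeneralPosition S) {T₁ T₂ : SimpleGraph S}
    (hne : T₁ ≠ T₂) (h : IsRotation T₁ T₂) : IsCompatibleFlip T₁ T₂ := by
  obtain ⟨e, f, hex, v, hve, hvf⟩ := h
  refine ⟨e, f, hex, hS.nonCrossing_of_mem (T₁.not_isDiag_of_mem_edgeSet hex.1)
    (T₂.not_isDiag_of_mem_edgeSet hex.2.1) ?_ hve hvf⟩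
  -- Exchanging an edge for itself would leave the tree unchanged.
  rintro rfl
  apply hne
  rw [← SimpleGraph.edgeSet_inj, hex.2.2, Set.sdiff_union_self, Set.union_eq_left.2]
  simpa using hex.1

theorem rotationGraph_le_flipGraph : rotationGraph S ≤ flipGraph S := by
  have hrot : ∀ {T₁ T₂ : SimpleGraph S}, IsRotation T₁ T₂ → IsFlip T₁ T₂ :=
    fun ⟨e, f, hex, _⟩ => ⟨e, f, hex⟩
  intro C₁ C₂ h
  rw [rotationGraph, SimpleGraph.fromRel_adj] at h
  exact (SimpleGraph.fromRel_adj _ _ _).2 ⟨h.1, h.2.imp hrot hrot⟩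

theorem rotationGraph_le_compatibleFlipGraph (hS : InGeneralPosition S) :
    rotationGraph S ≤ compatibleFlipGraph S := by
  intro C₁ C₂ h
  rw [rotationGraph, SimpleGraph.fromRel_adj] at h
  have hne : C₁.1 ≠ C₂.1 := fun e => h.1 (Subtype.ext e)
  exact (SimpleGraph.fromRel_adj _ _ _).2
    ⟨h.1, h.2.imp (IsRotation.isCompatibleFlip hS hne) (IsRotation.isCompatibleFlip hS hne.symm)⟩

end Connectivity

end PlaneCaterpillar

theorem proposition2 (S : Finset PlaneCaterpillar.Plane) (hne : S.Nonempty)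
    (hS : PlaneCaterpillar.InGeneralPosition S) :
    (PlaneCaterpillar.rotationGraph S).Connected ∧
      (PlaneCaterpillar.flipGraph S).Connected ∧
      (PlaneCaterpillar.compatibleFlipGraph S).Connected := by
  have h := PlaneCaterpillar.rotationGraph_connected hne hS
  exact ⟨h, h.mono PlaneCaterpillar.rotationGraph_le_flipGraph,
    h.mono (PlaneCaterpillar.rotationGraph_le_compatibleFlipGraph hS)⟩
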